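/- Let $R$ be an associative ring with $1$, not necessarily commutative, in which every idempotent is central. Assume that $R$ is a principal ideal ring, that is, every left ideal and every right ideal of $R$ is principal. Then the following conditions are equivalent: 1. $R$ is endoartinian: for each of the modules $M = {}_RR$ and $M = R_R$, and for all endomorphisms $f_1, f_2, \dots$ of $M$ with $\operatorname{im}(f_1) \supseteq \operatorname{im}(f_2) \supseteq \cdots$, there is $n$ with $\operatorname{im}(f_k) = \operatorname{im}(f_n)$ for all $k \ge n$; 2. $R$ is a Köthe ring: every left $R$-module and every right $R$-module is a direct sum of cyclic submodules; 3. $R \cong \prod_{i=1}^n R_i$ as rings, for some $n \ge 0$, where each $R_i$ is left and right artinian and uniserial, i.e. the left ideals of $R_i$ are linearly ordered by inclusion, and so are its right ideals. -/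

import Mathlib

universe u v w

/-! Left modules over `R` are `Module R M`; right `R`-modules are `Module Rᵐᵒᵖ M`. The left and right
regular modules are `R` over `R` and `R` over `Rᵐᵒᵖ`; their submodules are the left, resp. right,
ideals of `R`. -/

/-- Every descending chain of images of endomorphisms of `M` stabilizes. -/
def IsEndoartinianModule (R : Type u) (M : Type w) [Ring R] [AddCommGroup M] [Module R M] : Prop :=
  ∀ f : ℕ → Module.End R M,
    (∀ n, LinearMap.range (f (n + 1)) ≤ LinearMap.range (f n)) →
      ∃ n, ∀ k, n ≤ k → LinearMap.range (f k) = LinearMap.range (f n)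

/-- A ring is endoartinian if both its left and its right regular module are. -/
def IsEndoartinianRing (R : Type u) [Ring R] : Prop :=
  IsEndoartinianModule R R ∧ IsEndoartinianModule Rᵐᵒᵖ R

/-- All left ideals and all right ideals are principal. -/
def IsTwoSidedPrincipalIdealRing (R : Type u) [Ring R] : Prop :=
  (∀ I : Submodule R R, I.IsPrincipal) ∧ (∀ I : Submodule Rᵐᵒᵖ R, I.IsPrincipal)

open Classical in
/-- `M` is an (internal) direct sum of cyclic submodules. -/
def IsDirectSumOfCyclics (R : Type u) (M : Type w) [Ring R] [AddCommGroup M] [Module R M] : Prop :=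
  ∃ (ι : Type w) (N : ι → Submodule R M), DirectSum.IsInternal N ∧ ∀ i, (N i).IsPrincipal

/-- Every left `R`-module and every right `R`-module is a direct sum of cyclic modules. The modules
range over an arbitrary universe not below that of `R`. -/
def IsKotheRing (R : Type u) [Ring R] : Prop :=
  (∀ (M : Type (max u v)) [AddCommGroup M] [Module R M], IsDirectSumOfCyclics R M) ∧
  (∀ (M : Type (max u v)) [AddCommGroup M] [Module Rᵐᵒᵖ M], IsDirectSumOfCyclics Rᵐᵒᵖ M)

/-- The submodules of `M` are linearly ordered by inclusion. -/
def IsUniserialModule (R : Type u) (M : Type w) [Ring R] [AddCommGroup M] [Module R M] : Prop :=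
  ∀ N K : Submodule R M, N ≤ K ∨ K ≤ N

/-- A ring is uniserial if its left and its right ideals are linearly ordered by inclusion. -/
def IsUniserialRing (R : Type u) [Ring R] : Prop :=
  IsUniserialModule R R ∧ IsUniserialModule Rᵐᵒᵖ R

/-- A left and right artinian ring. -/
def IsTwoSidedArtinianRing (R : Type u) [Ring R] : Prop :=
  IsArtinian R R ∧ IsArtinian Rᵐᵒᵖ R

/-! Principal one-sided ideals are images of endomorphisms of the regular module, so here
endoartinian means artinian (`IsEndoartinianModule.isArtinian`). An artinian `R` with central
idempotents splits along minimal idempotents into rings with only trivial idempotents. There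
Fitting's lemma makes every element a unit or nilpotent, and principality yields one nilpotent `p`
generating the nonunits on both sides. Every element is then a unit times a power of `p`, so such a
ring is uniserial and its modules decompose like bounded abelian p-groups
(`exists_isCyclicDecomposition`).

That a Köthe ring is artinian comes from decomposing one module, the reduced power of the ring
(`isArtinianRing_mulOpposite_of_forall_isDirectSumOfCyclics`): decomposing it as a left module stops
descending chains of right ideals. -/

open Submodule

/-! ### Cyclic decompositions in terms of generators -/

/-- The cyclic submodules generated by the family `m` are independent and span the module. -/
def IsCyclicDecomposition (R : Type u) {M : Type w} [Ring R] [AddCommGroup M] [Module R M]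
    {ι : Type*} (m : ι → M) : Prop :=
  (∀ (s : Finset ι) (c : ι → R), ∑ i ∈ s, c i • m i = 0 → ∀ i ∈ s, c i • m i = 0) ∧
    span R (Set.range m) = ⊤

theorem isDirectSumOfCyclics_iff {R : Type u} {M : Type w} [Ring R] [AddCommGroup M] [Module R M] :
    IsDirectSumOfCyclics R M ↔ ∃ (ι : Type w) (m : ι → M), IsCyclicDecomposition R m := by
  classical
  constructor
  · rintro ⟨ι, N, hN, hp⟩
    rw [DirectSum.isInternal_submodule_iff_iSupIndep_and_iSup_eq_top,
      iSupIndep_iff_finsetSum_eq_zero_imp_eq_zero] at hN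
    choose m hm using fun i => (hp i).principal
    refine ⟨ι, m, fun s c h => hN.1 s _ (fun i _ => ?_) h, ?_⟩
    · rw [hm i]; exact smul_mem _ _ (mem_span_singleton_self _)
    · rw [span_range_eq_iSup, ← hN.2]
      simp_rw [← hm]
  · rintro ⟨ι, m, h1, h2⟩
    refine ⟨ι, fun i => span R {m i}, ?_, fun i => ⟨⟨m i, rfl⟩⟩⟩
    rw [DirectSum.isInternal_submodule_iff_iSupIndep_and_iSup_eq_top,
      iSupIndep_iff_finsetSum_eq_zero_imp_eq_zero, ← span_range_eq_iSup]
    refine ⟨fun s x hx h0 i hi => ?_, h2⟩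
    have : ∀ i, ∃ c : R, i ∈ s → c • m i = x i := fun i => by
      by_cases hi : i ∈ s
      · obtain ⟨c, hc⟩ := mem_span_singleton.1 (hx i hi)
        exact ⟨c, fun _ => hc⟩
      · exact ⟨0, fun h => absurd h hi⟩
    choose c hc using this
    rw [← hc i hi]
    refine h1 s c ?_ i hi
    rw [← h0]
    exact Finset.sum_congr rfl hc

theorem subsingleton_of_isNilpotent_of_mul_eq_one {S : Type*} [Ring S] {p q : S}
    (hp : IsNilpotent p) (h : q * p = 1) : Subsingleton S := by
  obtain ⟨n, hn⟩ := hp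
  have hreg : IsLeftRegular p := isLeftRegular_of_mul_eq_one h
  have := hreg.pow n (a₁ := (1 : S)) (a₂ := 0) (by simp [hn])
  exact subsingleton_of_zero_eq_one this.symm

/-! ### Local rings with a nilpotent uniformizer -/

/-- A nilpotent element generating, on both sides, the ideal of nonunits. -/
structure IsNilpotentUniformizer {S : Type*} [Ring S] (p : S) : Prop where
  isNilpotent : IsNilpotent p
  isUnit_or_mul_left (a : S) : IsUnit a ∨ ∃ c, a = c * p
  isUnit_or_mul_right (a : S) : IsUnit a ∨ ∃ c, a = p * c

namespace IsNilpotentUniformizer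

variable {S : Type u} [Ring S] {p : S}

theorem op (hp : IsNilpotentUniformizer p) : IsNilpotentUniformizer (MulOpposite.op p) where
  isNilpotent := by
    obtain ⟨n, hn⟩ := hp.isNilpotent
    exact ⟨n, by rw [← MulOpposite.op_pow, hn, MulOpposite.op_zero]⟩
  isUnit_or_mul_left a := (hp.isUnit_or_mul_right a.unop).imp isUnit_unop.1
    fun ⟨c, hc⟩ => ⟨.op c, MulOpposite.unop_injective hc⟩
  isUnit_or_mul_right a := (hp.isUnit_or_mul_left a.unop).imp isUnit_unop.1
    fun ⟨c, hc⟩ => ⟨.op c, MulOpposite.unop_injective hc⟩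

/-- If `r * p` were a unit, `p` would be nilpotent and left invertible, which forces the ring to be
trivial. -/
theorem exists_mul_eq_mul (hp : IsNilpotentUniformizer p) (r : S) : ∃ r', r * p = p * r' := by
  rcases hp.isUnit_or_mul_right (r * p) with ⟨u, hu⟩ | h
  · have : (↑u⁻¹ * r) * p = 1 := by rw [mul_assoc, ← hu, Units.inv_mul]
    have := subsingleton_of_isNilpotent_of_mul_eq_one hp.isNilpotent this
    exact ⟨0, Subsingleton.elim _ _⟩
  · exact h

theorem exists_mul_pow_eq_pow_mul (hp : IsNilpotentUniformizer p) (k : ℕ) (r : S) :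
    ∃ r', r * p ^ k = p ^ k * r' := by
  induction k generalizing r with
  | zero => exact ⟨r, by simp⟩
  | succ k ih =>
    obtain ⟨r', h⟩ := ih r
    obtain ⟨r'', h'⟩ := hp.exists_mul_eq_mul r'
    exact ⟨r'', by rw [pow_succ, ← mul_assoc, h, mul_assoc, h', mul_assoc]⟩

theorem exists_pow_mul_eq_mul_pow (hp : IsNilpotentUniformizer p) (k : ℕ) (r : S) :
    ∃ r', p ^ k * r = r' * p ^ k := by
  obtain ⟨r', h⟩ := hp.op.exists_mul_pow_eq_pow_mul k (.op r)
  exact ⟨r'.unop, MulOpposite.op_injective (by simpa using h)⟩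

/-- Factors `p` are split off on the right until the cofactor is a unit; if that never happens,
nilpotency gives `a = 0`. -/
theorem exists_eq_unit_mul_pow (hp : IsNilpotentUniformizer p) (a : S) :
    ∃ (u : Sˣ) (k : ℕ), a = u * p ^ k := by
  have key : ∀ j : ℕ, (∃ (u : Sˣ) (k : ℕ), a = u * p ^ k) ∨ ∃ c, a = c * p ^ j := by
    intro j
    induction j with
    | zero => exact .inr ⟨a, by simp⟩
    | succ j ih =>
      obtain h | ⟨c, hc⟩ := ih
      · exact .inl h
      · obtain ⟨u, rfl⟩ | ⟨d, rfl⟩ := hp.isUnit_or_mul_left c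
        · exact .inl ⟨u, j, hc⟩
        · exact .inr ⟨d, by rw [hc, pow_succ', mul_assoc]⟩
  obtain ⟨n, hn⟩ := hp.isNilpotent
  obtain h | ⟨c, hc⟩ := key n
  · exact h
  · exact ⟨1, n, by simp [hc, hn]⟩

theorem isUniserialModule (hp : IsNilpotentUniformizer p) : IsUniserialModule S S := by
  intro N K
  by_contra! h
  obtain ⟨h1, h2⟩ := h
  obtain ⟨a, haN, haK⟩ := SetLike.not_le_iff_exists.1 h1
  obtain ⟨b, hbK, hbN⟩ := SetLike.not_le_iff_exists.1 h2
  obtain ⟨x, k, rfl⟩ := hp.exists_eq_unit_mul_pow a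
  obtain ⟨y, l, rfl⟩ := hp.exists_eq_unit_mul_pow b
  have mem {L : Submodule S S} {x y : Sˣ} {k l : ℕ} (hkl : k ≤ l) (h : (x : S) * p ^ k ∈ L) :
      (y : S) * p ^ l ∈ L := by
    have := L.smul_mem (y * p ^ (l - k) * ↑x⁻¹) h
    rwa [smul_eq_mul, mul_assoc (y * p ^ (l - k)), Units.inv_mul_cancel_left, mul_assoc,
      ← pow_add, Nat.sub_add_cancel hkl] at this
  rcases le_total k l with hkl | hkl
  · exact hbN (mem hkl haN)
  · exact haK (mem hkl hbK)

theorem isTwoSided_span (hp : IsNilpotentUniformizer p) : (Ideal.span {p}).IsTwoSided where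
  mul_mem_of_left {a} b ha := by
    obtain ⟨c, rfl⟩ := Ideal.mem_span_singleton'.1 ha
    obtain ⟨b', hb⟩ := hp.exists_pow_mul_eq_mul_pow 1 b
    rw [pow_one] at hb
    rw [mul_assoc, hb, ← mul_assoc]
    exact Ideal.mul_mem_left _ _ (Ideal.mem_span_singleton_self p)

/-- The residue division ring. -/
@[reducible]
noncomputable def residueDivisionRing [Nontrivial S] (hp : IsNilpotentUniformizer p) :
    haveI := hp.isTwoSided_span
    DivisionRing (S ⧸ Ideal.span {p}) :=
  haveI := hp.isTwoSided_span
  haveI : Nontrivial (S ⧸ Ideal.span {p}) := by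
    refine Submodule.Quotient.nontrivial_iff.2 fun h => ?_
    obtain ⟨q, hq⟩ := Ideal.mem_span_singleton'.1 ((Ideal.eq_top_iff_one _).1 h)
    exact not_subsingleton S (subsingleton_of_isNilpotent_of_mul_eq_one hp.isNilpotent hq)
  DivisionRing.ofIsUnitOrEqZero fun a => by
    obtain ⟨a, rfl⟩ := Ideal.Quotient.mk_surjective a
    refine (hp.isUnit_or_mul_left a).imp (fun h => h.map _) ?_
    rintro ⟨c, rfl⟩
    exact Ideal.Quotient.eq_zero_iff_mem.2
      (Ideal.mul_mem_left _ _ (Ideal.mem_span_singleton_self p))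

end IsNilpotentUniformizer

/-! ### Modules over a ring with a nilpotent uniformizer -/

/-- A vector space with a finite descending filtration has a basis adapted to the filtration. -/
theorem exists_linearIndepOn_adapted {D V : Type*} [DivisionRing D] [AddCommGroup V] [Module D V]
    (F : ℕ → Submodule D V) (hF : Antitone F) (n : ℕ) (hn : F n = ⊥) :
    ∃ B : Set V, LinearIndepOn D id B ∧ ∀ k, F k ≤ span D (B ∩ F k) := by
  -- The basis grows upwards from `F n = ⊥`; keeping `B ⊆ F (n - i)` allows extension within the
  -- next larger step.
  suffices h : ∀ i ≤ n, ∃ B : Set V, LinearIndepOn D id B ∧ B ⊆ F (n - i) ∧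
      ∀ k, n - i ≤ k → F k ≤ span D (B ∩ F k) by
    obtain ⟨B, h1, -, h2⟩ := h n le_rfl
    exact ⟨B, h1, fun k => h2 k (by simp)⟩
  intro i hi
  induction i with
  | zero =>
    refine ⟨∅, linearIndepOn_empty D id, Set.empty_subset _, fun k hk => ?_⟩
    refine (hF (show n ≤ k from hk)).trans ?_
    simp [hn]
  | succ i ih =>
    obtain ⟨B, h1, h2, h3⟩ := ih (by omega)
    obtain ⟨C, hC1, hC2, hC3, hC4⟩ := exists_linearIndepOn_extension h1
      (h2.trans (hF (show n - (i + 1) ≤ n - i by omega)))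
    refine ⟨C, hC4, hC1, fun k hk => ?_⟩
    rcases hk.eq_or_lt with rfl | hk
    · rw [Set.inter_eq_left.2 hC1]
      simpa using hC3
    · exact (h3 k (by omega)).trans (span_mono (Set.inter_subset_inter_left _ hC2))

namespace IsNilpotentUniformizer

variable {S : Type u} [Ring S] {p : S} {M : Type w} [AddCommGroup M] [Module S M]

/-- The elements annihilated by `p`. -/
def socle (hp : IsNilpotentUniformizer p) (M : Type w) [AddCommGroup M] [Module S M] :
    Submodule S M where
  carrier := {x | p • x = 0}
  add_mem' {x y} hx hy := by
    rw [Set.mem_ofPred_eq] at *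
    rw [smul_add, hx, hy, add_zero]
  zero_mem' := smul_zero p
  smul_mem' r x hx := by
    rw [Set.mem_ofPred_eq] at *
    obtain ⟨r', h⟩ := hp.exists_pow_mul_eq_mul_pow 1 r
    rw [pow_one] at h
    rw [← mul_smul, h, mul_smul, hx, smul_zero]

theorem mem_socle (hp : IsNilpotentUniformizer p) {x : M} : x ∈ hp.socle M ↔ p • x = 0 := Iff.rfl

theorem isTorsionBySet_socle (hp : IsNilpotentUniformizer p) :
    Module.IsTorsionBySet S (hp.socle M) (Ideal.span {p} : Ideal S) := by
  rintro ⟨x, hx⟩ ⟨a, ha⟩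
  obtain ⟨c, rfl⟩ := Ideal.mem_span_singleton'.1 ha
  apply Subtype.ext
  change (c * p) • x = 0
  rw [mul_smul, hp.mem_socle.1 hx, smul_zero]

/-- A nonzero element `b = p ^ k • x` of the socle generates the socle of `S • x`. -/
theorem exists_smul_eq_of_smul_eq_zero (hp : IsNilpotentUniformizer p) {x : M} {k : ℕ}
    (hk : p ^ k • x ≠ 0) (c : S) (hc : p • c • x = 0) : ∃ s : S, c • x = s • p ^ k • x := by
  obtain ⟨u, j, rfl⟩ := hp.exists_eq_unit_mul_pow c
  rcases le_or_gt k j with hkj | hkj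
  · exact ⟨u * p ^ (j - k), by rw [← mul_smul, mul_assoc, ← pow_add, Nat.sub_add_cancel hkj]⟩
  -- For `j < k`, moving `p` past the unit shows that `p ^ (j + 1)` already kills `x`.
  · refine absurd ?_ hk
    obtain ⟨v, hv⟩ := hp.exists_pow_mul_eq_mul_pow 1 ((↑u⁻¹ : Sˣ) : S)
    obtain ⟨i, rfl⟩ := Nat.exists_eq_add_of_lt hkj
    have : p ^ (j + i + 1) • x = (p ^ i * v) • p • (↑u * p ^ j) • x := by
      rw [pow_one] at hv
      simp only [← mul_smul]
      congr 1
      rw [mul_assoc, ← mul_assoc v, ← hv, mul_assoc, Units.inv_mul_cancel_left]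
      rw [← pow_succ', ← pow_add]
      congr 1
      omega
    rw [this, hc, smul_zero]

/-- The socle is a vector space over the residue division ring, filtered by its intersections with
`p ^ k M`. Each vector `b` of an adapted basis is divided by the largest possible power of `p`, and
the quotients `m b` are the generators. -/
theorem exists_isCyclicDecomposition (hp : IsNilpotentUniformizer p) :
    ∃ (ι : Type w) (m : ι → M), IsCyclicDecomposition S m := by
  rcases subsingleton_or_nontrivial S with hS | hS
  · have : Subsingleton M := Module.subsingleton S M
    exact ⟨PEmpty, fun i => i.elim, fun s c h i => i.elim, Subsingleton.elim _ _⟩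
  have := hp.isTwoSided_span
  let := hp.residueDivisionRing
  let : Module (S ⧸ Ideal.span {p}) (hp.socle M) := hp.isTorsionBySet_socle.module
  obtain ⟨n, hn⟩ := hp.isNilpotent
  let F : ℕ → Submodule (S ⧸ Ideal.span {p}) (hp.socle M) := fun k =>
    { carrier := {x | ∃ y : M, p ^ k • y = x}
      add_mem' := by
        rintro _ _ ⟨x, hx⟩ ⟨y, hy⟩
        exact ⟨x + y, by rw [smul_add, hx, hy]; rfl⟩
      zero_mem' := ⟨0, smul_zero _⟩
      smul_mem' := by
        rintro a x ⟨y, hy⟩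
        obtain ⟨a, rfl⟩ := Ideal.Quotient.mk_surjective a
        obtain ⟨b, hb⟩ := hp.exists_mul_pow_eq_pow_mul k a
        refine ⟨b • y, ?_⟩
        rw [← mul_smul, ← hb, mul_smul, hy]
        rfl }
  have memF {k : ℕ} {x : hp.socle M} : x ∈ F k ↔ ∃ y : M, p ^ k • y = x := Iff.rfl
  have hF : Antitone F := by
    rintro k l hkl x ⟨y, hy⟩
    exact ⟨p ^ (l - k) • y, by rw [← mul_smul, ← pow_add, Nat.add_sub_cancel' hkl, hy]⟩
  have hFn : F n = ⊥ := by
    rw [eq_bot_iff]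
    rintro x ⟨y, hy⟩
    rw [hn, zero_smul] at hy
    exact Subtype.ext hy.symm
  obtain ⟨B, hB, hspan⟩ := exists_linearIndepOn_adapted F hF n hFn
  have hdepth : ∀ b : B, ∃ k, (b : hp.socle M) ∈ F k ∧ ∀ j, (b : hp.socle M) ∈ F j → j ≤ k := by
    intro b
    have hb : (b : hp.socle M) ≠ 0 := hB.ne_zero b.2
    have hex : ∃ k, (b : hp.socle M) ∉ F k := ⟨n, by rwa [hFn, mem_bot]⟩
    classical
    -- `F 0` is the whole socle, so the depth of `b` is one less than the first `k` with `b ∉ F k`.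
    have hpos : Nat.find hex ≠ 0 := fun h0 => by
      have := Nat.find_spec hex
      rw [h0] at this
      exact this ⟨(b : hp.socle M), by simp⟩
    refine ⟨Nat.find hex - 1, not_not.1 (Nat.find_min hex (by omega)), fun j hj => ?_⟩
    by_contra! hlt
    exact Nat.find_spec hex (hF (by omega) hj)
  choose d hd hdmax using hdepth
  choose m hm using hd
  have hmne : ∀ b, p ^ d b • m b ≠ 0 := fun b h => by
    rw [hm b] at h
    exact hB.ne_zero b.2 (Subtype.ext h)
  refine ⟨B, m, fun s c h0 => ?_, ?_⟩
  -- Once `p ^ (t + 1)` kills all terms, `p ^ t` sends each into the socle of `S • m b`, hence to a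
  -- multiple of `b`; linear independence of the basis makes these vanish.
  · have key : ∀ t : ℕ, (∀ b ∈ s, p ^ t • c b • m b = 0) → ∀ b ∈ s, c b • m b = 0 := by
      intro t
      induction t with
      | zero => simp
      | succ t ih =>
        intro ht
        apply ih
        have : ∀ b : B, ∃ r : S, b ∈ s → p ^ t • c b • m b = r • p ^ d b • m b := fun b => by
          by_cases hb : b ∈ s
          · rw [← mul_smul]
            obtain ⟨r, hr⟩ := hp.exists_smul_eq_of_smul_eq_zero (hmne b) (p ^ t * c b) (by
              have := ht b hb
              rwa [pow_succ', mul_smul, ← mul_smul (p ^ t)] at this)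
            exact ⟨r, fun _ => hr⟩
          · exact ⟨0, fun h => absurd h hb⟩
        choose r hr using this
        have hsum : ∑ b ∈ s, Ideal.Quotient.mk (Ideal.span {p}) (r b) • (b : hp.socle M) = 0 := by
          apply Subtype.ext
          rw [AddSubmonoidClass.coe_finsetSum]
          have := congrArg (p ^ t • ·) h0
          simp only [smul_zero, Finset.smul_sum] at this
          rw [ZeroMemClass.coe_zero, ← this]
          refine Finset.sum_congr rfl fun b hb => ?_
          rw [hr b hb, hm b]
          rfl
        intro b hb
        have h1 := linearIndependent_iff'.1 hB s _ hsum b hb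
        rw [hr b hb, hm b]
        have h2 : Ideal.Quotient.mk (Ideal.span {p}) (r b) • (b : hp.socle M) = 0 := by
          rw [h1, zero_smul]
        exact congrArg Subtype.val h2
    exact key n fun b _ => by rw [hn, zero_smul]
  · set N := span S (Set.range m) with hN
    -- Basis vectors in `F j` have depth at least `j`, so they have a `p ^ j`-th root inside `N`.
    have lift : ∀ j (x : hp.socle M), x ∈ F j → ∃ y ∈ N, p ^ j • y = x := by
      intro j x hx
      refine span_induction (p := fun (x : hp.socle M) _ => ∃ y ∈ N, p ^ j • y = (x : M))
        ?_ ?_ ?_ ?_ (hspan j hx)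
      · rintro b ⟨hb, hbj⟩
        refine ⟨p ^ (d ⟨b, hb⟩ - j) • m ⟨b, hb⟩, N.smul_mem _ (subset_span ⟨_, rfl⟩), ?_⟩
        rw [← mul_smul, ← pow_add, Nat.add_sub_cancel' (hdmax ⟨b, hb⟩ j hbj), hm]
      · exact ⟨0, N.zero_mem, smul_zero _⟩
      · rintro x y _ _ ⟨x', hx', hx⟩ ⟨y', hy', hy⟩
        exact ⟨x' + y', N.add_mem hx' hy', by rw [smul_add, hx, hy]; rfl⟩
      · rintro a x _ ⟨y, hy, hxy⟩
        obtain ⟨a, rfl⟩ := Ideal.Quotient.mk_surjective a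
        obtain ⟨b, hb⟩ := hp.exists_mul_pow_eq_pow_mul j a
        refine ⟨b • y, N.smul_mem _ hy, ?_⟩
        rw [← mul_smul, ← hb, mul_smul, hxy]
        rfl
    have key : ∀ (j : ℕ) (x : M), p ^ j • x = 0 → x ∈ N := by
      intro j
      induction j with
      | zero =>
        intro x hx
        rw [pow_zero, one_smul] at hx
        rw [hx]; exact N.zero_mem
      | succ j ih =>
        intro x hx
        obtain ⟨y, hy, hxy⟩ := lift j ⟨p ^ j • x, by
          rwa [hp.mem_socle, ← mul_smul, ← pow_succ']⟩ ⟨x, rfl⟩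
        -- Subtracting `y ∈ N` lowers the power of `p` needed to kill `x`.
        have := ih (x - y) (by rw [smul_sub, hxy, sub_self])
        simpa using N.add_mem this hy
    exact eq_top_iff.2 fun x _ => key n x (by rw [hn, zero_smul])

end IsNilpotentUniformizer

/-! ### Modules over finite products -/

theorem isDirectSumOfCyclics_of_ringEquiv_pi {R : Type u} [Ring R] {n : ℕ} {S : Fin n → Type v}
    [∀ i, Ring (S i)] (φ : R ≃+* ((i : Fin n) → S i))
    (hS : ∀ i, ∃ p : S i, IsNilpotentUniformizer p)
    (M : Type w) [AddCommGroup M] [Module R M] : IsDirectSumOfCyclics R M := by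
  classical
  let e (i : Fin n) (s : S i) : R := φ.symm (Pi.single i s)
  have e_mul (i) (s t : S i) : e i s * e i t = e i (s * t) := by
    simp only [e, ← map_mul, Pi.single_mul]
  have e_ortho {i j} (hij : i ≠ j) (s : S i) (t : S j) : e i s * e j t = 0 := by
    simp only [e, ← map_mul]
    rw [← Pi.single_mul_left, Pi.single_eq_of_ne hij, mul_zero, Pi.single_zero, map_zero]
  have mul_e (r : R) (i) : r * e i 1 = e i (φ r i) := by
    apply φ.injective
    simp only [e, map_mul, RingEquiv.apply_symm_apply]
    rw [← Pi.single_mul_right, mul_one]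
  have e_mul' (r : R) (i) : e i 1 * r = e i (φ r i) := by
    apply φ.injective
    simp only [e, map_mul, RingEquiv.apply_symm_apply]
    rw [← Pi.single_mul_left, one_mul]
  have e_sum : ∑ i, e i 1 = 1 := by
    simp only [e, ← map_sum]
    rw [Finset.univ_sum_single (fun i => (1 : S i))]
    exact map_one φ.symm
  let N (i : Fin n) : Submodule R M :=
    { carrier := {x | e i 1 • x = x}
      add_mem' := fun {x y} (hx : e i 1 • x = x) (hy : e i 1 • y = y) => by
        change e i 1 • (x + y) = x + y
        rw [smul_add, hx, hy]
      zero_mem' := smul_zero _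
      smul_mem' := fun r x (hx : e i 1 • x = x) => by
        change e i 1 • r • x = r • x
        rw [← mul_smul, e_mul', ← mul_e, mul_smul, hx] }
  have hN {i} (x : N i) : e i 1 • (x : M) = x := x.2
  let (i : Fin n) : Module (S i) (N i) :=
    { smul := fun s x => e i s • x
      one_smul := fun x => Subtype.ext (hN x)
      mul_smul := fun s t x => by
        change e i (s * t) • x = e i s • e i t • x
        rw [← e_mul, mul_smul]
      smul_zero := fun s => smul_zero (e i s)
      smul_add := fun s x y => smul_add (e i s) x y
      add_smul := fun s t x => by
        change e i (s + t) • x = e i s • x + e i t • x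
        simp only [e, Pi.single_add, map_add, add_smul]
      zero_smul := fun x => by
        change e i 0 • x = 0
        simp only [e, Pi.single_zero, map_zero, zero_smul] }
  have smul_def {i} (s : S i) (x : N i) : s • x = e i s • x := rfl
  have smul_eq (r : R) {i} (x : N i) : φ r i • x = r • x := by
    rw [smul_def, ← mul_e, mul_smul]
    exact congrArg (r • ·) (Subtype.ext (hN x))
  have hdec : ∀ i, ∃ (ι : Type w) (m : ι → N i), IsCyclicDecomposition (S i) m := fun i =>
    (hS i).elim fun p hp => hp.exists_isCyclicDecomposition
  choose ι m hm using hdec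
  rw [isDirectSumOfCyclics_iff]
  refine ⟨Σ i, ι i, fun a => (m a.1 a.2 : M), fun s c h0 => ?_, ?_⟩
  · rintro ⟨i, j⟩ hij
    let s' : Finset (ι i) := s.preimage (Sigma.mk i) sigma_mk_injective.injOn
    have hsum : ∑ j ∈ s', φ (c ⟨i, j⟩) i • m i j = 0 := by
      apply Subtype.ext
      rw [AddSubmonoidClass.coe_finsetSum, ZeroMemClass.coe_zero]
      -- Multiplication by `e i 1` isolates the terms of the `i`-th component.
      have h1 := congrArg (e i 1 • ·) h0
      simp only [smul_zero, Finset.smul_sum] at h1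
      rw [← h1, ← Finset.sum_filter_add_sum_filter_not s (· ∈ Set.range (Sigma.mk i)),
        ← Finset.sum_preimage' (Sigma.mk i) s sigma_mk_injective.injOn
          (fun a => e i 1 • c a • (m a.1 a.2 : M)), Finset.sum_eq_zero (s := s.filter _), add_zero]
      · refine Finset.sum_congr rfl fun j _ => ?_
        rw [smul_eq, ← mul_smul, e_mul', ← mul_e, mul_smul, hN]
        rfl
      · rintro ⟨i', j'⟩ ha
        have hne : i ≠ i' := by
          rintro rfl
          exact (Finset.mem_filter.1 ha).2 ⟨j', rfl⟩
        rw [← hN (m i' j'), ← mul_smul, ← mul_smul, e_mul', e_ortho hne, zero_smul]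
    have := (hm i).1 s' (fun j => φ (c ⟨i, j⟩) i) hsum j (Finset.mem_preimage.2 hij)
    rw [smul_eq] at this
    exact congrArg Subtype.val this
  · rw [eq_top_iff]
    rintro x -
    rw [← one_smul R x, ← e_sum, Finset.sum_smul]
    refine sum_mem fun i _ => ?_
    have key : ∀ y : N i, (y : M) ∈ span R (Set.range fun a : Σ i, ι i => (m a.1 a.2 : M)) := by
      intro y
      have hy : y ∈ span (S i) (Set.range (m i)) := by rw [(hm i).2]; trivial
      induction hy using span_induction with
      | mem y hy =>
        obtain ⟨j, rfl⟩ := hy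
        exact subset_span ⟨⟨i, j⟩, rfl⟩
      | zero => exact zero_mem _
      | add y z _ _ hy hz => exact add_mem hy hz
      | smul s y _ hy => exact smul_mem _ (e i s) hy
    exact key ⟨e i 1 • x, by
      change e i 1 • e i 1 • x = _
      rw [← mul_smul, e_mul, one_mul]⟩

/-! ### Chain conditions from decompositions -/

/-- For a chain of right ideals `a n * S`, the class of `a` in the reduced power is a finite
combination of the generators `c j`, yet is left divisible by every `a k`. Comparing coefficients
puts `a n` in `a k * S`, with `n` independent of `k`. -/
theorem isArtinianRing_mulOpposite_of_forall_isDirectSumOfCyclics {S : Type u} [Ring S]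
    [IsPrincipalIdealRing S] [IsPrincipalIdealRing Sᵐᵒᵖ]
    (hS : ∀ (M : Type (max u v)) [AddCommGroup M] [Module S M], IsDirectSumOfCyclics S M) :
    IsArtinianRing Sᵐᵒᵖ := by
  rw [IsArtinianRing, ← monotone_stabilizes_iff_artinian]
  intro I
  choose g hg using fun n => (IsPrincipalIdealRing.principal (OrderDual.ofDual (I n))).principal
  let a (n : ℕ) : S := (g n).unop
  have hdvd : ∀ k n : ℕ, ∃ y, k ≤ n → a n = a k * y := fun k n => by
    by_cases hkn : k ≤ n
    · have h : g n ∈ OrderDual.ofDual (I k) := by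
        refine I.monotone hkn ?_
        change g n ∈ OrderDual.ofDual (I n)
        rw [hg n]
        exact mem_span_singleton_self _
      rw [hg k, mem_span_singleton] at h
      obtain ⟨c, hc⟩ := h
      exact ⟨c.unop, fun _ => by simp only [a, ← hc, smul_eq_mul, MulOpposite.unop_mul]⟩
    · exact ⟨0, fun h => absurd h hkn⟩
  choose y hy using hdvd
  -- decompose the reduced power of `S`, i.e. sequences modulo eventually zero sequences
  let Z : Submodule S (ℕ → S) :=
    { carrier := {f | ∀ᶠ n in Filter.atTop, f n = 0}
      add_mem' := fun {f g} (hf : ∀ᶠ n in Filter.atTop, f n = 0)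
          (hg : ∀ᶠ n in Filter.atTop, g n = 0) => (hf.and hg).mono fun n h => by
        rw [Pi.add_apply, h.1, h.2, add_zero]
      zero_mem' := Filter.Eventually.of_forall fun _ => rfl
      smul_mem' := fun c f (hf : ∀ᶠ n in Filter.atTop, f n = 0) => hf.mono fun n h => by
        rw [Pi.smul_apply, h, smul_zero] }
  let Φ : (ℕ → S) →ₗ[S] ULift.{v} ((ℕ → S) ⧸ Z) := ULift.moduleEquiv.symm.toLinearMap ∘ₗ Z.mkQ
  have hΦ : Function.Surjective Φ := ULift.moduleEquiv.symm.surjective.comp Z.mkQ_surjective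
  have hker : ∀ f, Φ f = 0 ↔ ∀ᶠ n in Filter.atTop, f n = 0 := fun f => by
    rw [LinearMap.comp_apply, LinearEquiv.coe_coe, LinearEquiv.map_eq_zero_iff, mkQ_apply,
      Quotient.mk_eq_zero]
    rfl
  obtain ⟨ι, c, hind, hspan⟩ := isDirectSumOfCyclics_iff.1 (hS (ULift.{v} ((ℕ → S) ⧸ Z)))
  choose f hf using fun j => hΦ (c j)
  -- A principal annihilator turns all relations on `c j` into the single equation `r j • c j = 0`,
  -- so representatives satisfy them all from some index on.
  choose r hr using fun j =>
    (IsPrincipalIdealRing.principal (LinearMap.ker (LinearMap.toSpanSingleton S _ (c j)))).principal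
  have hrc : ∀ j, r j • c j = 0 := fun j => by
    have : r j ∈ LinearMap.ker (LinearMap.toSpanSingleton S _ (c j)) := by
      rw [hr j]; exact mem_span_singleton_self _
    simpa using this
  have hann : ∀ j s, s • c j = 0 → ∃ q, s = q * r j := fun j s hs => by
    have : s ∈ LinearMap.ker (LinearMap.toSpanSingleton S _ (c j)) := by simpa using hs
    rw [hr j, mem_span_singleton] at this
    obtain ⟨q, hq⟩ := this
    exact ⟨q, hq.symm⟩
  have hex : ∀ x, ∃ t : ι →₀ S, (t.sum fun j b => b • c j) = x := fun x =>
    Finsupp.mem_span_range_iff_exists_finsupp.1 (hspan ▸ mem_top)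
  obtain ⟨t, ht⟩ := hex (Φ a)
  have hev1 : ∀ᶠ n in Filter.atTop, a n - ∑ j ∈ t.support, t j * f j n = 0 := by
    have h0 : Φ (a - ∑ j ∈ t.support, t j • f j) = 0 := by
      rw [map_sub, map_sum, ← ht, Finsupp.sum, sub_eq_zero]
      exact Finset.sum_congr rfl fun j _ => by rw [map_smul, hf]
    simpa using (hker _).1 h0
  have hev2 : ∀ᶠ n in Filter.atTop, ∀ j ∈ t.support, r j * f j n = 0 := by
    rw [Filter.eventually_all_finset]
    intro j _
    exact (hker (r j • f j)).1 (by rw [map_smul, hf, hrc])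
  -- Only the finite support of `t` matters, so `n` is fixed before `k` appears.
  obtain ⟨n, hn1, hn2⟩ := (hev1.and hev2).exists
  refine ⟨n, fun k hk => le_antisymm (I.monotone hk) ?_⟩
  change OrderDual.ofDual (I n) ≤ OrderDual.ofDual (I k)
  obtain ⟨s, hs⟩ := hex (Φ (y k))
  have hrel : a k • Φ (y k) = Φ a := by
    rw [← sub_eq_zero, ← map_smul, ← map_sub, hker]
    filter_upwards [Filter.eventually_ge_atTop k] with l hl
    rw [Pi.sub_apply, Pi.smul_apply, smul_eq_mul, ← hy k l hl, sub_self]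
  classical
  have hsum : ∑ j ∈ s.support ∪ t.support, (a k * s j - t j) • c j = 0 := by
    rw [← hs, ← ht, Finsupp.sum_of_support_subset s Finset.subset_union_left _ (by simp),
      Finsupp.sum_of_support_subset t Finset.subset_union_right _ (by simp), ← sub_eq_zero,
      Finset.smul_sum, ← Finset.sum_sub_distrib] at hrel
    rw [← hrel]
    exact Finset.sum_congr rfl fun j _ => by rw [sub_smul, mul_smul]
  have hmul : a n = a k * ∑ j ∈ t.support, s j * f j n := by
    rw [sub_eq_zero.1 hn1, Finset.mul_sum]
    refine Finset.sum_congr rfl fun j hj => ?_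
    obtain ⟨q, hq⟩ := hann j _ (hind _ _ hsum j (Finset.mem_union_right _ hj))
    rw [← sub_eq_zero, ← mul_assoc, ← sub_mul, ← neg_sub, hq, neg_mul, mul_assoc, hn2 j hj,
      mul_zero, neg_zero]
  rw [hg n, span_singleton_le_iff_mem, hg k, mem_span_singleton]
  exact ⟨.op (∑ j ∈ t.support, s j * f j n), MulOpposite.unop_injective hmul.symm⟩

/-! ### Rings whose nonunits are nilpotent -/

/-- Fitting's lemma for right multiplication by `a`: the component `l` of `1` in the image is
idempotent. If `l = 0` a power of `a` vanishes; if `l = 1` then `a` is left invertible. -/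
theorem isUnit_or_isNilpotent_of_isArtinianRing {S : Type u} [Ring S] [IsArtinianRing S]
    [IsNoetherianRing S] (hS : ∀ e : S, IsIdempotentElem e → e = 0 ∨ e = 1) (a : S) :
    IsUnit a ∨ IsNilpotent a := by
  let f : Module.End S S := LinearMap.toSpanSingleton S S a
  have hf : ∀ (n : ℕ) (x : S), (f ^ n) x = x * a ^ n := fun n => by
    induction n with
    | zero => simp
    | succ n ih =>
      intro x
      rw [pow_succ', Module.End.mul_apply, ih, pow_succ, ← mul_assoc]
      rfl
  obtain ⟨n, hn⟩ := (f.eventually_isCompl_ker_pow_range_pow.and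
    (Filter.eventually_ge_atTop 1)).exists
  obtain ⟨hc, hn1⟩ := hn
  obtain ⟨k, hk, l, hl, hkl⟩ := mem_sup.1 (hc.sup_eq_top ▸ mem_top : (1 : S) ∈ _)
  have hlk : l * k = 0 := by
    refine (disjoint_def.1 hc.disjoint) _ (smul_mem _ l hk) ?_
    have : l * k = l - l * l := by rw [eq_sub_iff_add_eq, ← mul_add, hkl, mul_one]
    rw [this]
    exact sub_mem hl (smul_mem _ l hl)
  have hidem : IsIdempotentElem l := by
    have := congrArg (l * ·) hkl
    simp only [mul_add, hlk, zero_add, mul_one] at this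
    exact this
  obtain ⟨r, hr⟩ := hl
  rw [hf] at hr
  obtain h0 | h1 := hS l hidem
  · refine .inr ⟨n, ?_⟩
    rw [h0, add_zero] at hkl
    rw [hkl] at hk
    simpa [hf] using hk
  · left
    rw [h1] at hr
    have h : (r * a ^ (n - 1)) * a = 1 := by
      rw [mul_assoc, ← pow_succ, Nat.sub_add_cancel hn1, hr]
    exact IsUnit.of_mul_eq_one _ (mul_eq_one_symm h)

section NonunitsNilpotent

variable {S : Type u} [Ring S]

theorem mul_eq_one_symm_of_isUnit_or_isNilpotent (hS : ∀ a : S, IsUnit a ∨ IsNilpotent a)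
    {a b : S} (h : a * b = 1) : b * a = 1 := by
  obtain ⟨u, rfl⟩ | hb := hS b
  · rw [← Units.inv_eq_of_mul_eq_one_left h, Units.mul_inv]
  · have := subsingleton_of_isNilpotent_of_mul_eq_one hb h
    exact Subsingleton.elim _ _

theorem not_isUnit_mul_of_not_isUnit_right (hS : ∀ a : S, IsUnit a ∨ IsNilpotent a)
    (r : S) {a : S} (ha : ¬IsUnit a) : ¬IsUnit (r * a) := by
  rintro ⟨u, hu⟩
  have h : (↑u⁻¹ * r) * a = 1 := by rw [mul_assoc, ← hu, Units.inv_mul]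
  exact ha ⟨⟨a, ↑u⁻¹ * r, mul_eq_one_symm_of_isUnit_or_isNilpotent hS h, h⟩, rfl⟩

theorem not_isUnit_mul_of_not_isUnit_left (hS : ∀ a : S, IsUnit a ∨ IsNilpotent a)
    (r : S) {a : S} (ha : ¬IsUnit a) : ¬IsUnit (a * r) := by
  rintro ⟨u, hu⟩
  have h : a * (r * ↑u⁻¹) = 1 := by rw [← mul_assoc, ← hu, Units.mul_inv]
  exact ha ⟨⟨a, r * ↑u⁻¹, h, mul_eq_one_symm_of_isUnit_or_isNilpotent hS h⟩, rfl⟩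

/-- If `u = a + b` were a unit, `u⁻¹ * a` would be `1` minus a nilpotent, hence a unit. -/
theorem not_isUnit_add (hS : ∀ a : S, IsUnit a ∨ IsNilpotent a) {a b : S} (ha : ¬IsUnit a)
    (hb : ¬IsUnit b) : ¬IsUnit (a + b) := by
  rintro ⟨u, hu⟩
  have h : ↑u⁻¹ * a = 1 - ↑u⁻¹ * b := by rw [eq_sub_iff_add_eq, ← mul_add, ← hu, Units.inv_mul]
  have hnil := (hS (↑u⁻¹ * b)).resolve_left (not_isUnit_mul_of_not_isUnit_right hS _ hb)
  exact not_isUnit_mul_of_not_isUnit_right hS _ ha (h ▸ hnil.isUnit_one_sub)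

theorem exists_generator_nonunits [Nontrivial S] [IsPrincipalIdealRing S]
    (hS : ∀ a : S, IsUnit a ∨ IsNilpotent a) :
    ∃ p : S, ¬IsUnit p ∧ ∀ a, ¬IsUnit a → ∃ c, a = c * p := by
  let J : Ideal S :=
    { carrier := nonunits S
      add_mem' := not_isUnit_add hS
      zero_mem' := not_isUnit_zero
      smul_mem' := fun r _ => not_isUnit_mul_of_not_isUnit_right hS r }
  obtain ⟨p, hp⟩ := (IsPrincipalIdealRing.principal J).principal
  have hpJ : p ∈ J := hp ▸ mem_span_singleton_self p
  refine ⟨p, hpJ, fun a ha => ?_⟩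
  have : a ∈ J := ha
  rw [hp, mem_span_singleton] at this
  exact this.imp fun c hc => hc.symm

/-- Let `p` and `q` generate the nonunits on the left and on the right, with `p = q * t`. If `t` is
a unit, `p` generates on the right too. Otherwise `t = s * p`, so `(1 - q * s) * p = 0` with `q * s`
nilpotent, and `p = 0`. -/
theorem exists_isNilpotentUniformizer [IsPrincipalIdealRing S] [IsPrincipalIdealRing Sᵐᵒᵖ]
    (hS : ∀ a : S, IsUnit a ∨ IsNilpotent a) : ∃ p : S, IsNilpotentUniformizer p := by
  rcases subsingleton_or_nontrivial S with h | h
  · exact ⟨0, .zero, fun a => .inl (isUnit_of_subsingleton a),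
      fun a => .inl (isUnit_of_subsingleton a)⟩
  have hSop : ∀ a : Sᵐᵒᵖ, IsUnit a ∨ IsNilpotent a := fun a =>
    (hS a.unop).imp isUnit_unop.1 fun ⟨n, hn⟩ => ⟨n, MulOpposite.unop_injective (by simpa using hn)⟩
  obtain ⟨p, hp, hpgen⟩ := exists_generator_nonunits hS
  obtain ⟨q', hq', hqgen'⟩ := exists_generator_nonunits hSop
  let q := q'.unop
  have hq : ¬IsUnit q := fun h => hq' (isUnit_unop.1 h)
  have hqgen : ∀ a, ¬IsUnit a → ∃ c, a = q * c := fun a ha => by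
    obtain ⟨c, hc⟩ := hqgen' (.op a) fun h => ha (isUnit_op.1 h)
    exact ⟨c.unop, MulOpposite.op_injective (by simpa [q] using hc)⟩
  have hpright : ∀ a, ¬IsUnit a → ∃ c, a = p * c := by
    obtain ⟨t, ht⟩ := hqgen p hp
    by_cases hu : IsUnit t
    · obtain ⟨t, rfl⟩ := hu
      intro a ha
      obtain ⟨c, rfl⟩ := hqgen a ha
      exact ⟨↑t⁻¹ * c, by rw [ht, mul_assoc, Units.mul_inv_cancel_left]⟩
    · obtain ⟨s, rfl⟩ := hpgen t hu
      have hnil := (hS (q * s)).resolve_left (not_isUnit_mul_of_not_isUnit_left hS s hq)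
      have h0 : (1 - q * s) * p = 0 := by
        rw [sub_mul, one_mul, mul_assoc, ← ht, sub_self]
      have hp0 : p = 0 := (hnil.isUnit_one_sub.mul_right_eq_zero).1 h0
      intro a ha
      obtain ⟨c, rfl⟩ := hpgen a ha
      exact ⟨0, by rw [hp0, mul_zero, mul_zero]⟩
  exact ⟨p, (hS p).resolve_left hp, fun a => or_iff_not_imp_left.2 (hpgen a),
    fun a => or_iff_not_imp_left.2 (hpright a)⟩

end NonunitsNilpotent

/-! ### Splitting along central idempotents -/

section CentralIdempotents

variable {R : Type u} [Ring R]

/-- A nonzero idempotent that is minimal for the order `g ≤ f ↔ g * f = g`. -/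
def IsMinimalIdempotent (f : R) : Prop :=
  IsIdempotentElem f ∧ f ≠ 0 ∧ ∀ g, IsIdempotentElem g → g * f = g → g = 0 ∨ g = f

theorem IsMinimalIdempotent.mul_eq_zero (hR : ∀ e : R, IsIdempotentElem e → e ∈ Set.center R)
    {f g : R} (hf : IsMinimalIdempotent f) (hg : IsMinimalIdempotent g) (hne : f ≠ g) :
    f * g = 0 := by
  have hcomm : Commute f g := (hR f hf.1).comm g
  have hidem : IsIdempotentElem (f * g) := hf.1.mul_of_commute hcomm hg.1
  by_contra h0
  have h1 := (hg.2.2 _ hidem (by rw [mul_assoc, hg.1.eq])).resolve_left h0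
  have h2 := (hf.2.2 _ hidem (by rw [mul_assoc, ← hcomm.eq, ← mul_assoc, hf.1.eq])).resolve_left h0
  exact hne (h2.symm.trans h1)

/-- A non-minimal `e` splits as `f + (e - f)`, and both parts generate strictly smaller left ideals.
-/
theorem exists_finset_isMinimalIdempotent_sum_eq [IsArtinianRing R]
    (hR : ∀ e : R, IsIdempotentElem e → e ∈ Set.center R) (e : R) (he : IsIdempotentElem e) :
    ∃ s : Finset R, (∀ f ∈ s, IsMinimalIdempotent f) ∧ ∑ f ∈ s, f = e := by
  classical
  induction h : Ideal.span {e} using WellFoundedLT.induction generalizing e with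
  | ind I ih =>
  subst h
  by_cases h0 : e = 0
  · exact ⟨∅, by simp, by simp [h0]⟩
  by_cases hmin : IsMinimalIdempotent e
  · exact ⟨{e}, by simpa using hmin, by simp⟩
  obtain ⟨f, hf, hfe, hf0, hfne⟩ : ∃ f, IsIdempotentElem f ∧ f * e = f ∧ f ≠ 0 ∧ f ≠ e := by
    by_contra! hcon
    refine hmin ⟨he, h0, fun g hg hge => ?_⟩
    by_cases hg0 : g = 0
    · exact .inl hg0
    · exact .inr (hcon g hg hge hg0)
  have hlt : ∀ g, IsIdempotentElem g → g * e = g → g ≠ e → Ideal.span {g} < Ideal.span {e} := by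
    intro g hg hge hne
    refine lt_of_le_of_ne ?_ fun heq => hne ?_
    · rw [Ideal.span_singleton_le_iff_mem, Ideal.mem_span_singleton']
      exact ⟨g, hge⟩
    · obtain ⟨r, hr⟩ := Ideal.mem_span_singleton'.1 (heq ▸ Ideal.mem_span_singleton_self e)
      rw [← hge, (hR g hg).comm e, ← hr, mul_assoc, hg.eq]
  have hef : e * f = f := by rw [← (hR f hf).comm e, hfe]
  have hg : IsIdempotentElem (e - f) := by
    rw [IsIdempotentElem, sub_mul, mul_sub, mul_sub, he.eq, hf.eq, hef, hfe, sub_self, sub_zero]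
  obtain ⟨s, hs, hsum⟩ := ih _ (hlt f hf hfe hfne) f hf rfl
  obtain ⟨t, ht, htum⟩ := ih _ (hlt (e - f) hg (by rw [sub_mul, he.eq, hfe])
    (by simpa using hf0)) (e - f) hg rfl
  have hmul : ∀ s : Finset R, (∀ f ∈ s, IsMinimalIdempotent f) → ∀ x ∈ s, x * ∑ f ∈ s, f = x := by
    intro s hs x hx
    rw [Finset.mul_sum, Finset.sum_eq_single_of_mem x hx, (hs x hx).1.eq]
    exact fun y hy hyx => (hs x hx).mul_eq_zero hR (hs y hy) hyx.symm
  -- A common `x` would satisfy `x = x * f` and `x = x * (e - f)`, hence vanish.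
  have hdisj : Disjoint s t := by
    rw [Finset.disjoint_left]
    intro x hxs hxt
    have h1 := hmul s hs x hxs
    have h2 := hmul t ht x hxt
    rw [hsum] at h1
    rw [htum, ← h1, mul_assoc, mul_sub, hfe, hf.eq, sub_self, mul_zero] at h2
    exact (hs x hxs).2.1 (by rw [← h1, ← h2])
  refine ⟨s ∪ t, fun x hx => (Finset.mem_union.1 hx).elim (hs x) (ht x), ?_⟩
  rw [Finset.sum_union hdisj, hsum, htum, add_sub_cancel]

theorem exists_ringEquiv_pi_isNilpotentUniformizer [IsArtinianRing R] [IsPrincipalIdealRing R]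
    [IsPrincipalIdealRing Rᵐᵒᵖ] (hR : ∀ e : R, IsIdempotentElem e → e ∈ Set.center R) :
    ∃ (n : ℕ) (S : Fin n → Type u) (_ : ∀ i, Ring (S i)),
      (∀ i, ∃ p : S i, IsNilpotentUniformizer p) ∧ Nonempty (R ≃+* ((i : Fin n) → S i)) := by
  obtain ⟨s, hs, hsum⟩ := exists_finset_isMinimalIdempotent_sum_eq hR 1 .one
  let e (i : Fin s.card) : R := s.equivFin.symm i
  have hmin (i) : IsMinimalIdempotent (e i) := hs _ (s.equivFin.symm i).2
  have he : CompleteOrthogonalIdempotents e :=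
    { idem := fun i => (hmin i).1
      ortho := fun i j hij => (hmin i).mul_eq_zero hR (hmin j) fun h =>
        hij (s.equivFin.symm.injective (Subtype.ext h))
      complete := by
        rw [← hsum, ← Finset.sum_coe_sort s]
        exact Equiv.sum_comp s.equivFin.symm (fun x : s => (x : R)) }
  let φ := he.ringEquivOfIsMulCentral fun i => hR _ (hmin i).1
  refine ⟨s.card, fun i => (he.idem i).Corner, fun i => inferInstance, fun i => ?_, ⟨φ⟩⟩
  let π : R →+* (he.idem i).Corner := (Pi.evalRingHom _ i).comp φ.toRingHom
  have hπ : Function.Surjective π := (Function.surjective_eval i).comp φ.surjective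
  have : IsArtinianRing (he.idem i).Corner := hπ.isArtinianRing
  have : IsPrincipalIdealRing (he.idem i).Corner := .of_surjective π hπ
  have : IsPrincipalIdealRing (he.idem i).Cornerᵐᵒᵖ := .of_surjective (RingHom.op π) fun x =>
    (hπ x.unop).elim fun r hr => ⟨.op r, by
      change MulOpposite.op (π r) = x
      rw [hr, MulOpposite.op_unop]⟩
  -- An idempotent of the corner is an idempotent of `R` below `e i`, so minimality makes it
  -- trivial.
  refine exists_isNilpotentUniformizer (isUnit_or_isNilpotent_of_isArtinianRing fun g hg => ?_)
  refine ((hmin i).2.2 g.1 (congrArg Subtype.val hg)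
    (congrArg Subtype.val (mul_one g))).imp (fun h => Subtype.ext h) fun h => Subtype.ext h

end CentralIdempotents

/-! ### Passage between sides and between chain conditions -/

/-- The right regular module of `R` is the left regular module of `Rᵐᵒᵖ`. -/
def mulOppositeRegularEquiv (R : Type u) [Ring R] : Rᵐᵒᵖ ≃ₗ[Rᵐᵒᵖ] R :=
  (MulOpposite.opLinearEquiv Rᵐᵒᵖ).symm

section Transfer

variable {R : Type u} {M : Type v} {N : Type w} [Ring R] [AddCommGroup M] [Module R M]
  [AddCommGroup N] [Module R N]

theorem LinearEquiv.forall_isPrincipal (g : M ≃ₗ[R] N) (h : ∀ K : Submodule R N, K.IsPrincipal)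
    (K : Submodule R M) : K.IsPrincipal := by
  have := (h (K.map g.toLinearMap)).map g.symm.toLinearMap
  rwa [← Submodule.map_comp, LinearEquiv.comp_coe, LinearEquiv.self_trans_symm,
    LinearEquiv.refl_toLinearMap, Submodule.map_id] at this

theorem IsUniserialModule.of_linearEquiv (g : M ≃ₗ[R] N) (h : IsUniserialModule R M) :
    IsUniserialModule R N := fun K L => by
  have := h (K.comap g.toLinearMap) (L.comap g.toLinearMap)
  simpa only [Submodule.comap_le_comap_iff_of_surjective g.surjective] using this

theorem IsArtinian.isEndoartinianModule (h : IsArtinian R M) : IsEndoartinianModule R M := by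
  intro f hf
  obtain ⟨n, hn⟩ := IsArtinian.monotone_stabilizes
    (⟨fun n => OrderDual.toDual (LinearMap.range (f n)), monotone_nat_of_le_succ hf⟩ :
      ℕ →o (Submodule R M)ᵒᵈ)
  exact ⟨n, fun k hk => (hn k hk).symm⟩

/-- Over a cyclic free module with principal submodules every submodule is the image of an
endomorphism. -/
theorem IsEndoartinianModule.isArtinian (h : IsEndoartinianModule R M) (g : R ≃ₗ[R] M)
    (hM : ∀ K : Submodule R M, K.IsPrincipal) : IsArtinian R M := by
  rw [← monotone_stabilizes_iff_artinian]
  intro I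
  choose x hx using fun n => (hM (OrderDual.ofDual (I n))).principal
  let f (n : ℕ) : Module.End R M := LinearMap.toSpanSingleton R M (x n) ∘ₗ g.symm.toLinearMap
  have hf : ∀ n, LinearMap.range (f n) = OrderDual.ofDual (I n) := fun n => by
    rw [LinearMap.range_comp_of_range_eq_top _ g.symm.range, hx n,
      LinearMap.range_toSpanSingleton]
  obtain ⟨n, hn⟩ := h f fun n => by
    rw [hf, hf]
    exact I.monotone n.le_succ
  refine ⟨n, fun k hk => ?_⟩
  have := hn k hk
  rw [hf, hf] at this
  exact this.symm

end Transfer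

/-! ### The equivalence -/

theorem mainTheorem2 (R : Type u) [Ring R]
    (hidem : ∀ e : R, IsIdempotentElem e → e ∈ Set.center R)
    (hpir : IsTwoSidedPrincipalIdealRing R) :
    List.TFAE [
      IsEndoartinianRing R,
      IsKotheRing.{u, v} R,
      ∃ (n : ℕ) (S : Fin n → Type u) (_ : ∀ i, Ring (S i)),
        (∀ i, IsTwoSidedArtinianRing (S i) ∧ IsUniserialRing (S i)) ∧
          Nonempty (R ≃+* ((i : Fin n) → S i))] := by
  have : IsPrincipalIdealRing R := ⟨hpir.1⟩
  have : IsPrincipalIdealRing Rᵐᵒᵖ := ⟨(mulOppositeRegularEquiv R).forall_isPrincipal hpir.2⟩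
  have : IsPrincipalIdealRing Rᵐᵒᵖᵐᵒᵖ :=
    .of_surjective (RingEquiv.opOp R) (RingEquiv.opOp R).surjective
  have hop : ∀ (S : Type u) [Ring S], IsArtinian Sᵐᵒᵖ S ↔ IsArtinianRing Sᵐᵒᵖ := fun S _ =>
    (mulOppositeRegularEquiv S).isArtinian_iff.symm
  have opEquiv {n : ℕ} {S : Fin n → Type u} [∀ i, Ring (S i)] (φ : R ≃+* ((i : Fin n) → S i)) :
      Rᵐᵒᵖ ≃+* ((i : Fin n) → (S i)ᵐᵒᵖ) := (RingEquiv.op φ).trans (RingEquiv.piMulOpposite S)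
  have hstruct (hR : IsArtinianRing R) := exists_ringEquiv_pi_isNilpotentUniformizer hidem
  tfae_have 1 → 2 := by
    rintro ⟨h, -⟩
    obtain ⟨n, S, _, hS, ⟨φ⟩⟩ := hstruct (h.isArtinian (LinearEquiv.refl R R) hpir.1)
    exact ⟨fun M => isDirectSumOfCyclics_of_ringEquiv_pi φ hS M,
      fun M => isDirectSumOfCyclics_of_ringEquiv_pi (opEquiv φ)
        (fun i => (hS i).elim fun p hp => ⟨_, hp.op⟩) M⟩
  tfae_have 2 → 3 := by
    rintro ⟨hl, hr⟩
    -- Decompositions on one side control ideals on the other: left modules give the right chain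
    -- condition, right modules the left one.
    have hRop : IsArtinianRing Rᵐᵒᵖ :=
      isArtinianRing_mulOpposite_of_forall_isDirectSumOfCyclics.{u, v} hl
    have hRopop : IsArtinianRing Rᵐᵒᵖᵐᵒᵖ :=
      isArtinianRing_mulOpposite_of_forall_isDirectSumOfCyclics.{u, v} hr
    have hR : IsArtinianRing R := (RingEquiv.opOp R).symm.isArtinianRing
    obtain ⟨n, S, _, hS, ⟨φ⟩⟩ := hstruct hR
    refine ⟨n, S, _, fun i => ?_, ⟨φ⟩⟩
    obtain ⟨p, hp⟩ := hS i
    have hl : IsArtinianRing (S i) := Function.Surjective.isArtinianRing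
      (f := (Pi.evalRingHom S i).comp φ.toRingHom) ((Function.surjective_eval i).comp φ.surjective)
    have hr : IsArtinianRing (S i)ᵐᵒᵖ := Function.Surjective.isArtinianRing
      (f := (Pi.evalRingHom (fun i => (S i)ᵐᵒᵖ) i).comp (opEquiv φ).toRingHom)
      ((Function.surjective_eval i).comp (opEquiv φ).surjective)
    exact ⟨⟨hl, (hop (S i)).2 hr⟩, hp.isUniserialModule,
      .of_linearEquiv (mulOppositeRegularEquiv (S i)) hp.op.isUniserialModule⟩
  tfae_have 3 → 1 := by
    rintro ⟨n, S, _, hS, ⟨φ⟩⟩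
    have hl (i) : IsArtinianRing (S i) := (hS i).1.1
    have hr (i) : IsArtinianRing (S i)ᵐᵒᵖ := (hop (S i)).1 (hS i).1.2
    have hR : IsArtinianRing R := φ.symm.isArtinianRing
    have hRop : IsArtinianRing Rᵐᵒᵖ := (opEquiv φ).symm.isArtinianRing
    exact ⟨IsArtinian.isEndoartinianModule hR, IsArtinian.isEndoartinianModule ((hop R).2 hRop)⟩
  tfae_finish
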